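/- A network (weighted directed graph) $G=(X,\omega)$ is a set $X$ of vertices with a function $\omega:X\times X\to[0,\infty]$. The weight of a path $(x_0,x_1,\dots,x_m)$, $m\ge 0$, is $\sum_{i<m}\omega(x_i,x_{i+1})$ (so it is $0$ for a constant path), and $d_G(x,y)$ denotes the infimum of the weights of all paths from $x$ to $y$. For $\delta\in\mathbb{R}$, let $\mathfrak{D}_\delta(G)$ be the Dowker source complex of the path completion $(X,d_G)$: the abstract simplicial complex whose simplices are the nonempty finite sets $\sigma\subseteq X$ for which there is $y\in X$ with $d_G(x,y)\le\delta$ for all $x\in\sigma$. Let $\tilde H_n$ denote reduced simplicial homology with real coefficients. Let $G_1=(X_1,\omega_1)$ and $G_2=(X_2,\omega_2)$ be networks with distinguished vertices $x_0\in X_1$ and $y_0\in X_2$. Let $G_1\vee G_2$ be their wedge sum, that is, the network on $(X_1\sqcup X_2)/(x_0\sim y_0)$ whose weights are those of $G_1$ and $G_2$, with weight $\infty$ on every pair of vertices that comes from neither network (on the pair consisting of the common base vertex twice, the smaller of the two weights is taken). Let $\delta\in\mathbb{R}$, and suppose that each base vertex shares a $\delta$-neighborhood with at least one other vertex of its network: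 there are $x\in X_1\setminus\{x_0\}$ and $z\in X_1$ with $d_{G_1}(x_0,z)\le\delta$ and $d_{G_1}(x,z)\le\delta$, and likewise for $y_0$ in $G_2$. Then for every $n\ge 0$ $$\tilde H_n(\mathfrak{D}_\delta(G_1\vee G_2))\;\cong\;\tilde H_n(\mathfrak{D}_\delta(G_1))\oplus\tilde H_n(\mathfrak{D}_\delta(G_2)).$$ -/

import Mathlib

open scoped ENNReal

noncomputable section

/-! ### Networks and path completion -/

/-- A network (weighted digraph) on the vertex set `X`: a weight in `[0, ∞]` for each ordered
pair of vertices, `∞` meaning that there is no edge. -/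
structure Network (X : Type*) where
  weight : X → X → ℝ≥0∞

namespace Network

variable {X X₁ X₂ : Type*}

/-- The weight of the path `(x, x₁, …, xₙ)`, where `l = [x₁, …, xₙ]`: the sum of the weights of
consecutive pairs. It is `0` for the constant path `(x)`. -/
def pathWeight (G : Network X) : X → List X → ℝ≥0∞
  | _, [] => 0
  | x, y :: l => G.weight x y + G.pathWeight y l

/-- The shortest path function: the infimum of the weights of all paths `(x, x₁, …, xₙ)` whose
last vertex is `y`. -/
def shortestPath (G : Network X) (x y : X) : ℝ≥0∞ :=
  ⨅ (l : List X) (_ : (x :: l).getLast (List.cons_ne_nil x l) = y), G.pathWeight x l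

/-- The path completion `P(G)`. -/
def pathCompletion (G : Network X) : Network X where
  weight := G.shortestPath

/-- The relation `R_δ(G)`: `x` is related to `y` when `ω(x, y) ≤ δ`. The comparison is made in
the extended reals, so that it never holds for `δ < 0`. -/
def rel (G : Network X) (δ : EReal) (x y : X) : Prop :=
  (G.weight x y : EReal) ≤ δ

/-- The vertex `x₀` shares a `δ`-neighborhood with at least one other vertex: some vertex
`x ≠ x₀` and `x₀` lie in the `δ`-neighborhood of a common vertex `z`. -/
def SharesNeighborhood (G : Network X) (δ : EReal) (x₀ : X) : Prop :=
  ∃ x, x ≠ x₀ ∧ ∃ z, G.rel δ x₀ z ∧ G.rel δ x z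

end Network

/-! ### Wedge sums of networks -/

/-- The relation on the disjoint union that identifies the two base vertices. -/
inductive WedgeRel {X₁ X₂ : Type*} (x₀ : X₁) (y₀ : X₂) : X₁ ⊕ X₂ → X₁ ⊕ X₂ → Prop
  | base : WedgeRel x₀ y₀ (Sum.inl x₀) (Sum.inr y₀)

/-- The vertex set of the wedge sum: `X₁ ⊔ X₂` with `x₀` and `y₀` identified. -/
def WedgeVertex {X₁ X₂ : Type*} (x₀ : X₁) (y₀ : X₂) : Type _ :=
  Quot (WedgeRel x₀ y₀)

namespace WedgeVertex

variable {X₁ X₂ : Type*} (x₀ : X₁) (y₀ : X₂)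

/-- The first vertex set inside that of the wedge sum. -/
def inl (a : X₁) : WedgeVertex x₀ y₀ := Quot.mk _ (Sum.inl a)

/-- The second vertex set inside that of the wedge sum. -/
def inr (b : X₂) : WedgeVertex x₀ y₀ := Quot.mk _ (Sum.inr b)

end WedgeVertex

namespace Network

/-- The wedge sum of two networks: their union with the base vertices identified. An edge of the
wedge sum is an edge of `G₁` or an edge of `G₂`, so the weight of `(p, q)` is the least weight of
an edge of `G₁` or `G₂` that becomes `(p, q)`, and `∞` if there is none. (Only the pair formed
by the base vertex twice arises from both networks.) -/
def wedge {X₁ X₂ : Type*} (G₁ : Network X₁) (G₂ : Network X₂) (x₀ : X₁) (y₀ : X₂) :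
    Network (WedgeVertex x₀ y₀) where
  weight p q :=
    min
      (⨅ (a : X₁) (b : X₁) (_ : WedgeVertex.inl x₀ y₀ a = p ∧ WedgeVertex.inl x₀ y₀ b = q),
        G₁.weight a b)
      (⨅ (a : X₂) (b : X₂) (_ : WedgeVertex.inr x₀ y₀ a = p ∧ WedgeVertex.inr x₀ y₀ b = q),
        G₂.weight a b)

end Network

/-! ### Dowker complexes -/

/-- The Dowker source complex of a relation `R` between `X` and `Y`: the simplices are the
(nonempty finite) sets `σ ⊆ X` for which some `y` satisfies `R x y` for every `x ∈ σ`. -/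
def dowkerSource {X Y : Type*} (R : X → Y → Prop) : PreAbstractSimplicialComplex X where
  faces := {σ | σ.Nonempty ∧ ∃ y, ∀ x ∈ σ, R x y}
  isRelLowerSet_faces := by
    rintro σ ⟨hσ, y, hy⟩
    exact ⟨hσ, fun τ hτ hne => ⟨hne, y, fun x hx => hy x (hτ hx)⟩⟩

/-- The Dowker source complex `𝔇_δ(G)` of the path completion of `G` at scale `δ`. -/
def Network.dowker {X : Type*} (G : Network X) (δ : EReal) : PreAbstractSimplicialComplex X :=
  dowkerSource (G.pathCompletion.rel δ)

/-! ### Reduced simplicial homology with coefficients in a commutative ring -/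

section Homology

variable (k : Type*) [CommRing k] {V : Type*} [LinearOrder V]

/-- The boundary map of simplices oriented by the order of the vertices:
`∂ [v₀ < ⋯ < v_k] = ∑ i, (-1) ^ i [v₀, …, v̂ᵢ, …, v_k]`. The index of the vertex `a` in `σ` is
the number of vertices of `σ` below `a`. On a `0`-simplex this is the augmentation `[v] ↦ [∅]`. -/
def simplexBoundary (V : Type*) [LinearOrder V] : (Finset V →₀ k) →ₗ[k] (Finset V →₀ k) :=
  Finsupp.linearCombination k fun σ : Finset V =>
    ∑ a ∈ σ, Finsupp.single (σ.erase a) ((-1 : k) ^ (σ.filter (· < a)).card)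

/-- The `n`-chains of `K`: finite formal `k`-linear combinations of `n`-simplices. -/
def simplicialChains (K : PreAbstractSimplicialComplex V) (n : ℕ) : Submodule k (Finset V →₀ k) :=
  Finsupp.supported k k {σ : Finset V | σ ∈ K ∧ σ.card = n + 1}

/-- The reduced `n`-cycles of `K`; for `n = 0` these are the `0`-chains of augmentation `0`. -/
def reducedCycles (K : PreAbstractSimplicialComplex V) (n : ℕ) : Submodule k (Finset V →₀ k) :=
  simplicialChains k K n ⊓ LinearMap.ker (simplexBoundary k V)

/-- The `n`-boundaries of `K`. -/
def simplicialBoundaries (K : PreAbstractSimplicialComplex V) (n : ℕ) :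
    Submodule k (Finset V →₀ k) :=
  (simplicialChains k K (n + 1)).map (simplexBoundary k V)

/-- The quotient `Z / B` of two submodules of a module (used for `B ≤ Z`). -/
abbrev Subquotient {k M : Type*} [CommRing k] [AddCommGroup M] [Module k M]
    (Z B : Submodule k M) : Type _ :=
  Z ⧸ B.submoduleOf Z

/-- The reduced homology `H̃ₙ(K; k)`: reduced cycles modulo boundaries (the boundaries are
cycles, see `simplicialBoundaries_le_reducedCycles`). -/
abbrev reducedHomology (K : PreAbstractSimplicialComplex V) (n : ℕ) : Type _ :=
  Subquotient (reducedCycles k K n) (simplicialBoundaries k K n)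

theorem simplexBoundary_single (σ : Finset V) :
    simplexBoundary k V (Finsupp.single σ 1) =
      ∑ a ∈ σ, Finsupp.single (σ.erase a) ((-1 : k) ^ (σ.filter (· < a)).card) := by
  simp [simplexBoundary]

theorem simplexBoundary_comp : simplexBoundary k V ∘ₗ simplexBoundary k V = 0 := by
  have key : ∀ σ : Finset V,
      simplexBoundary k V (simplexBoundary k V (Finsupp.single σ 1)) = 0 := by
    intro σ
    have h1 : simplexBoundary k V (simplexBoundary k V (Finsupp.single σ 1)) =
        ∑ p ∈ (σ ×ˢ σ).filter (fun p => p.1 ≠ p.2), Finsupp.single ((σ.erase p.1).erase p.2)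
          ((-1 : k) ^ (σ.filter (· < p.1)).card *
            (-1 : k) ^ ((σ.erase p.1).filter (· < p.2)).card) := by
      rw [simplexBoundary_single k, map_sum, Finset.sum_filter, Finset.sum_product]
      refine Finset.sum_congr rfl fun a ha => ?_
      rw [← mul_one ((-1 : k) ^ (σ.filter (· < a)).card), ← smul_eq_mul,
        ← Finsupp.smul_single, map_smul, simplexBoundary_single, Finset.smul_sum,
        ← Finset.sum_filter]
      refine Finset.sum_congr (by ext b; simp [and_comm, eq_comm]) fun b _ => ?_
      simp [Finsupp.smul_single]
    rw [h1]
    refine Finset.sum_involution (fun p _ => (p.2, p.1)) ?_ ?_ ?_ ?_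
    · rintro ⟨a, b⟩ hp
      simp only [Finset.mem_filter, Finset.mem_product] at hp
      obtain ⟨⟨ha, hb⟩, hne⟩ := hp
      have aux : ∀ c d : V, c ∈ σ → d ∈ σ → c < d →
          (-1 : k) ^ (σ.filter (· < d)).card *
            (-1 : k) ^ ((σ.erase d).filter (· < c)).card =
          -((-1 : k) ^ (σ.filter (· < c)).card *
            (-1 : k) ^ ((σ.erase c).filter (· < d)).card) := by
        intro c d hc hd hcd
        have e1 : (σ.erase d).filter (· < c) = σ.filter (· < c) := by
          ext x
          simp only [Finset.mem_filter, Finset.mem_erase]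
          exact ⟨fun h => ⟨h.1.2, h.2⟩, fun h => ⟨⟨(h.2.trans hcd).ne, h.1⟩, h.2⟩⟩
        have e2 : (σ.erase c).filter (· < d) = (σ.filter (· < d)).erase c := by
          ext x
          simp only [Finset.mem_filter, Finset.mem_erase]
          tauto
        have e3 : ((σ.filter (· < d)).erase c).card + 1 = (σ.filter (· < d)).card :=
          Finset.card_erase_add_one (by simp [hc, hcd])
        rw [e1, e2, ← e3, pow_succ]
        ring
      dsimp only
      rw [Finset.erase_right_comm (a := b) (b := a), ← Finsupp.single_add]
      rcases lt_or_gt_of_ne hne with h | h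
      · rw [aux a b ha hb h, add_neg_cancel, Finsupp.single_zero]
      · rw [aux b a hb ha h, neg_add_cancel, Finsupp.single_zero]
    · rintro ⟨a, b⟩ hp _ heq
      simp only [Finset.mem_filter] at hp
      exact hp.2 (congrArg Prod.snd heq)
    · rintro ⟨a, b⟩ hp
      simp only [Finset.mem_filter, Finset.mem_product] at hp ⊢
      exact ⟨⟨hp.1.2, hp.1.1⟩, hp.2.symm⟩
    · rintro ⟨a, b⟩ _
      rfl
  refine Finsupp.lhom_ext' fun σ => LinearMap.ext_ring ?_
  simpa using key σ

theorem simplicialBoundaries_le_reducedCycles (K : PreAbstractSimplicialComplex V) (n : ℕ) :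
    simplicialBoundaries k K n ≤ reducedCycles k K n := by
  refine le_inf ?_ ?_
  · rw [simplicialBoundaries, simplicialChains, Finsupp.supported_eq_span_single,
      Submodule.map_span, Submodule.span_le]
    rintro _ ⟨_, ⟨σ, ⟨hσ, hcard⟩, rfl⟩, rfl⟩
    rw [SetLike.mem_coe, simplexBoundary_single]
    refine Submodule.sum_mem _ fun a ha => Finsupp.single_mem_supported k _ ?_
    have hc : (σ.erase a).card = n + 1 := by
      have := Finset.card_erase_add_one ha
      omega
    exact ⟨(K.isRelLowerSet_faces hσ).2 (Finset.erase_subset a σ)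
      (Finset.card_pos.mp (by omega)), hc⟩
  · rintro _ ⟨c, _, rfl⟩
    exact LinearMap.congr_fun (simplexBoundary_comp k (V := V)) c

end Homology

end

open scoped ENNReal

noncomputable section

/-! ### Shortest paths and the wedge sum -/

namespace Network

variable {X Y : Type*}

/-! Each side of the wedge embeds in it, and collapsing the other side to the base vertex is a
retraction. None of these maps increases shortest paths, so the simplices of the wedge complex `K`
lying on one side are exactly those of that side's own Dowker complex. `K` may also have mixed
simplices, contained in neither side. If the common neighbor `q` lies on one side, some vertex of
the simplex lies on the other, and a path from it to `q` is no shorter than the distance from the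
base vertex `b` to `q`. Hence `b` can be added to every mixed simplex
(`insert_base_mem_dowker_wedge`). Coning off with apex `b` makes chains homologous to unmixed ones
(`exists_sub_boundary_mem_supported`), and unmixed chains split because the two sides meet only in
`b` (`exists_add_of_mem_supported`). This gives the direct sum in
`nonempty_reducedHomology_equiv_prod`. The three vertex orders need not be compatible, so `chainMap`
carries a sign counting inversions. -/

theorem shortestPath_self (G : Network X) (x : X) : G.shortestPath x x = 0 :=
  le_antisymm (iInf₂_le_of_le [] rfl le_rfl) zero_le

theorem shortestPath_le_weight (G : Network X) (x y : X) : G.shortestPath x y ≤ G.weight x y :=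
  iInf₂_le_of_le [y] rfl (by simp [pathWeight])

theorem shortestPath_le_weight_add (G : Network X) (x y z : X) :
    G.shortestPath x z ≤ G.weight x y + G.shortestPath y z := by
  simp only [shortestPath, ENNReal.add_iInf]
  refine le_iInf₂ fun l hl => iInf₂_le_of_le (y :: l) ?_ le_rfl
  simpa using hl

theorem shortestPath_triangle (G : Network X) (x y z : X) :
    G.shortestPath x z ≤ G.shortestPath x y + G.shortestPath y z := by
  conv_rhs => rw [shortestPath, ENNReal.iInf_add]
  refine le_iInf fun l => ?_
  rw [ENNReal.iInf_add]
  refine le_iInf fun hl => ?_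
  subst hl
  induction l generalizing x with
  | nil => simp [pathWeight]
  | cons a l ih =>
    refine (G.shortestPath_le_weight_add x a z).trans ?_
    rw [pathWeight, add_assoc]
    gcongr
    simpa using ih a

/-- A vertex map that does not increase the length of edges does not increase shortest paths. -/
theorem shortestPath_map_le (G : Network X) (H : Network Y) (f : X → Y)
    (hf : ∀ a b, H.shortestPath (f a) (f b) ≤ G.weight a b) (x y : X) :
    H.shortestPath (f x) (f y) ≤ G.shortestPath x y := by
  refine le_iInf₂ fun l hl => ?_
  subst hl
  induction l generalizing x with
  | nil => simp [pathWeight, shortestPath_self]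
  | cons a l ih =>
    refine (H.shortestPath_triangle _ (f a) _).trans ?_
    rw [pathWeight]
    exact add_le_add (hf x a) (by simpa using ih a)

end Network

namespace WedgeVertex

variable {X₁ X₂ : Type*} (x₀ : X₁) (y₀ : X₂)

/-- The retraction of the wedge sum onto the first vertex set. -/
def fst : WedgeVertex x₀ y₀ → X₁ :=
  Quot.lift (Sum.elim id fun _ => x₀) (by rintro _ _ ⟨⟩; rfl)

/-- The retraction of the wedge sum onto the second vertex set. -/
def snd : WedgeVertex x₀ y₀ → X₂ :=
  Quot.lift (Sum.elim (fun _ => y₀) id) (by rintro _ _ ⟨⟩; rfl)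

@[simp] theorem fst_inl (a : X₁) : fst x₀ y₀ (inl x₀ y₀ a) = a := rfl
@[simp] theorem fst_inr (b : X₂) : fst x₀ y₀ (inr x₀ y₀ b) = x₀ := rfl
@[simp] theorem snd_inl (a : X₁) : snd x₀ y₀ (inl x₀ y₀ a) = y₀ := rfl
@[simp] theorem snd_inr (b : X₂) : snd x₀ y₀ (inr x₀ y₀ b) = b := rfl

theorem inl_base : inl x₀ y₀ x₀ = inr x₀ y₀ y₀ := Quot.sound WedgeRel.base

/-- The first vertex set embeds in the wedge sum. -/
def inlEmbedding : X₁ ↪ WedgeVertex x₀ y₀ :=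
  ⟨inl x₀ y₀, Function.LeftInverse.injective (fst_inl x₀ y₀)⟩

/-- The second vertex set embeds in the wedge sum. -/
def inrEmbedding : X₂ ↪ WedgeVertex x₀ y₀ :=
  ⟨inr x₀ y₀, Function.LeftInverse.injective (snd_inr x₀ y₀)⟩

theorem exists_inl_or_inr (p : WedgeVertex x₀ y₀) :
    (∃ a, inl x₀ y₀ a = p) ∨ ∃ b, inr x₀ y₀ b = p := by
  induction p using Quot.ind with
  | mk s => exact s.casesOn (fun a => .inl ⟨a, rfl⟩) fun b => .inr ⟨b, rfl⟩

end WedgeVertex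

namespace Network

open WedgeVertex

variable {X₁ X₂ : Type*} (G₁ : Network X₁) (G₂ : Network X₂) (x₀ : X₁) (y₀ : X₂)

theorem shortestPath_inl_le (a b : X₁) :
    (G₁.wedge G₂ x₀ y₀).shortestPath (inl x₀ y₀ a) (inl x₀ y₀ b) ≤ G₁.shortestPath a b :=
  shortestPath_map_le _ _ _ (fun a b => (shortestPath_le_weight _ _ _).trans
    (min_le_of_left_le (iInf₂_le_of_le a b (iInf_le_of_le ⟨rfl, rfl⟩ le_rfl)))) _ _

theorem shortestPath_inr_le (a b : X₂) :
    (G₁.wedge G₂ x₀ y₀).shortestPath (inr x₀ y₀ a) (inr x₀ y₀ b) ≤ G₂.shortestPath a b :=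
  shortestPath_map_le _ _ _ (fun a b => (shortestPath_le_weight _ _ _).trans
    (min_le_of_right_le (iInf₂_le_of_le a b (iInf_le_of_le ⟨rfl, rfl⟩ le_rfl)))) _ _

/-- The retraction keeps the edges of `G₁` and turns those of `G₂` into the constant path at `x₀`.
Its weight is `0`, even if the loop at `x₀` has positive weight. -/
theorem shortestPath_fst_le (p q : WedgeVertex x₀ y₀) :
    G₁.shortestPath (fst x₀ y₀ p) (fst x₀ y₀ q) ≤ (G₁.wedge G₂ x₀ y₀).shortestPath p q := by
  refine shortestPath_map_le _ _ _ (fun p q => le_min ?_ ?_) _ _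
  · refine le_iInf₂ fun a b => le_iInf ?_
    rintro ⟨rfl, rfl⟩
    exact shortestPath_le_weight _ _ _
  · refine le_iInf₂ fun a b => le_iInf ?_
    rintro ⟨rfl, rfl⟩
    simp [shortestPath_self]

theorem shortestPath_snd_le (p q : WedgeVertex x₀ y₀) :
    G₂.shortestPath (snd x₀ y₀ p) (snd x₀ y₀ q) ≤ (G₁.wedge G₂ x₀ y₀).shortestPath p q := by
  refine shortestPath_map_le _ _ _ (fun p q => le_min ?_ ?_) _ _
  · refine le_iInf₂ fun a b => le_iInf ?_
    rintro ⟨rfl, rfl⟩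
    simp [shortestPath_self]
  · refine le_iInf₂ fun a b => le_iInf ?_
    rintro ⟨rfl, rfl⟩
    exact shortestPath_le_weight _ _ _

/-! ### Simplices of the Dowker complex of a wedge sum -/

variable {X : Type*}

theorem mem_dowker {G : Network X} {δ : EReal} {σ : Finset X} :
    σ ∈ G.dowker δ ↔ σ.Nonempty ∧ ∃ y, ∀ x ∈ σ, (G.shortestPath x y : EReal) ≤ δ :=
  Iff.rfl

theorem nonneg_of_sharesNeighborhood {G : Network X} {δ : EReal} {x : X}
    (h : G.SharesNeighborhood δ x) : 0 ≤ δ := by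
  obtain ⟨_, _, _, h, _⟩ := h
  exact (EReal.coe_ennreal_nonneg _).trans h

theorem singleton_mem_dowker (G : Network X) {δ : EReal} (hδ : 0 ≤ δ) (x : X) :
    {x} ∈ G.dowker δ :=
  mem_dowker.2 ⟨Finset.singleton_nonempty x, x, by simpa [shortestPath_self] using hδ⟩

/-- A common neighbor in the wedge is retracted to one in `X₁`, and a common neighbor in `X₁` is
included in the wedge. -/
theorem map_inl_mem_dowker_wedge {δ : EReal} {σ : Finset X₁} :
    σ.map (inlEmbedding x₀ y₀) ∈ (G₁.wedge G₂ x₀ y₀).dowker δ ↔ σ ∈ G₁.dowker δ := by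
  simp only [mem_dowker, Finset.map_nonempty, Finset.forall_mem_map]
  refine and_congr_right fun _ => ⟨fun ⟨q, hq⟩ => ⟨fst x₀ y₀ q, fun a ha => ?_⟩,
    fun ⟨b, hb⟩ => ⟨inl x₀ y₀ b, fun a ha => ?_⟩⟩
  · exact (EReal.coe_ennreal_le_coe_ennreal_iff.2
      (shortestPath_fst_le G₁ G₂ x₀ y₀ (inl x₀ y₀ a) q)).trans (hq a ha)
  · exact (EReal.coe_ennreal_le_coe_ennreal_iff.2
      (shortestPath_inl_le G₁ G₂ x₀ y₀ a b)).trans (hb a ha)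

theorem map_inr_mem_dowker_wedge {δ : EReal} {σ : Finset X₂} :
    σ.map (inrEmbedding x₀ y₀) ∈ (G₁.wedge G₂ x₀ y₀).dowker δ ↔ σ ∈ G₂.dowker δ := by
  simp only [mem_dowker, Finset.map_nonempty, Finset.forall_mem_map]
  refine and_congr_right fun _ => ⟨fun ⟨q, hq⟩ => ⟨snd x₀ y₀ q, fun a ha => ?_⟩,
    fun ⟨b, hb⟩ => ⟨inr x₀ y₀ b, fun a ha => ?_⟩⟩
  · exact (EReal.coe_ennreal_le_coe_ennreal_iff.2
      (shortestPath_snd_le G₁ G₂ x₀ y₀ (inr x₀ y₀ a) q)).trans (hq a ha)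
  · exact (EReal.coe_ennreal_le_coe_ennreal_iff.2
      (shortestPath_inr_le G₁ G₂ x₀ y₀ a b)).trans (hb a ha)

/-- A simplex with vertices on both sides of the wedge sum remains a simplex when the base vertex
is added. -/
theorem insert_base_mem_dowker_wedge [DecidableEq (WedgeVertex x₀ y₀)] {δ : EReal}
    {σ : Finset (WedgeVertex x₀ y₀)} (hσ : σ ∈ (G₁.wedge G₂ x₀ y₀).dowker δ)
    (h₁ : ¬ (σ : Set (WedgeVertex x₀ y₀)) ⊆ Set.range (inlEmbedding x₀ y₀))
    (h₂ : ¬ (σ : Set (WedgeVertex x₀ y₀)) ⊆ Set.range (inrEmbedding x₀ y₀)) :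
    insert (inl x₀ y₀ x₀) σ ∈ (G₁.wedge G₂ x₀ y₀).dowker δ := by
  obtain ⟨_, q, hq⟩ := mem_dowker.1 hσ
  refine mem_dowker.2 ⟨Finset.insert_nonempty _ _, q, ?_⟩
  rw [Finset.forall_mem_insert]
  refine ⟨?_, hq⟩
  obtain ⟨p₁, hp₁, hp₁'⟩ := Set.not_subset.1 h₁
  obtain ⟨p₂, hp₂, hp₂'⟩ := Set.not_subset.1 h₂
  rcases exists_inl_or_inr x₀ y₀ q with ⟨z, rfl⟩ | ⟨z, rfl⟩
  · rcases exists_inl_or_inr x₀ y₀ p₁ with ⟨a, rfl⟩ | ⟨b, rfl⟩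
    · exact absurd ⟨a, rfl⟩ hp₁'
    -- Here `q` lies in the first side and `p₁` in the second, so `fst` sends `p₁` to `x₀` and fixes
    -- `z`.
    · refine le_trans (EReal.coe_ennreal_le_coe_ennreal_iff.2 ?_) (hq _ hp₁)
      exact (shortestPath_inl_le G₁ G₂ x₀ y₀ x₀ z).trans
        (shortestPath_fst_le G₁ G₂ x₀ y₀ (inr x₀ y₀ b) (inl x₀ y₀ z))
  · rcases exists_inl_or_inr x₀ y₀ p₂ with ⟨a, rfl⟩ | ⟨b, rfl⟩
    · refine le_trans (EReal.coe_ennreal_le_coe_ennreal_iff.2 ?_) (hq _ hp₂)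
      rw [inl_base]
      exact (shortestPath_inr_le G₁ G₂ x₀ y₀ y₀ z).trans
        (shortestPath_snd_le G₁ G₂ x₀ y₀ (inl x₀ y₀ a) (inr x₀ y₀ z))
    · exact absurd ⟨b, rfl⟩ hp₂'

end Network

/-! ### The cone operator on oriented chains -/

section Cone

variable (k : Type*) [CommRing k] {V : Type*} [LinearOrder V]

/-- The cone operator with apex `b`: it adds the vertex `b` to a simplex. -/
def coneOperator (b : V) : (Finset V →₀ k) →ₗ[k] (Finset V →₀ k) :=
  Finsupp.linearCombination k fun σ : Finset V =>
    if b ∈ σ then 0 else Finsupp.single (insert b σ) ((-1 : k) ^ (σ.filter (· < b)).card)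

theorem coneOperator_single (b : V) (σ : Finset V) (r : k) :
    coneOperator k b (Finsupp.single σ r) =
      if b ∈ σ then 0 else Finsupp.single (insert b σ) (r * (-1 : k) ^ (σ.filter (· < b)).card) := by
  simp [coneOperator, smul_ite]

theorem simplexBoundary_single_smul (σ : Finset V) (r : k) :
    simplexBoundary k V (Finsupp.single σ r) =
      ∑ a ∈ σ, Finsupp.single (σ.erase a) (r * (-1 : k) ^ (σ.filter (· < a)).card) := by
  simp [simplexBoundary, Finset.smul_sum]

variable {k}

theorem simplexBoundary_simplexBoundary (c : Finset V →₀ k) :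
    simplexBoundary k V (simplexBoundary k V c) = 0 :=
  LinearMap.congr_fun (simplexBoundary_comp k (V := V)) c

/-- Erasing `a` moves the position of `b` exactly when `a < b`; inserting `b` moves the position of
`a` exactly when `b < a`. One of the two happens, which produces the sign. -/
theorem neg_one_pow_insert_erase {σ : Finset V} {a b : V} (ha : a ∈ σ) (hb : b ∉ σ) :
    (-1 : k) ^ (σ.filter (· < b)).card * (-1 : k) ^ ((insert b σ).filter (· < a)).card =
      -((-1 : k) ^ (σ.filter (· < a)).card * (-1 : k) ^ ((σ.erase a).filter (· < b)).card) := by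
  have hab : a ≠ b := fun h => hb (h ▸ ha)
  rw [Finset.filter_insert, Finset.filter_erase]
  rcases lt_or_gt_of_ne hab with h | h
  · rw [if_neg h.not_gt, ← Finset.card_erase_add_one (s := σ.filter (· < b)) (a := a)
      (by simp [ha, h]), pow_succ]
    ring
  · rw [if_pos h, Finset.card_insert_of_notMem (by simp [hb]),
      Finset.erase_eq_of_notMem (by simp [h.le]), pow_succ]
    ring

/-- The cone operator contracts the augmented chain complex of all finite sets. If `b ∈ σ`, only the
face without `b` survives coning, and it returns `σ`. Otherwise the face of the cone opposite `b` is
`σ`, and the remaining terms cancel in pairs. The empty simplex is included, as reduced homology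
requires. -/
theorem simplexBoundary_coneOperator_add (b : V) (c : Finset V →₀ k) :
    simplexBoundary k V (coneOperator k b c) + coneOperator k b (simplexBoundary k V c) = c := by
  suffices h : simplexBoundary k V ∘ₗ coneOperator k b + coneOperator k b ∘ₗ simplexBoundary k V =
      LinearMap.id from LinearMap.congr_fun h c
  refine Finsupp.lhom_ext' fun σ => LinearMap.ext_ring ?_
  simp only [LinearMap.comp_apply, LinearMap.add_apply, Finsupp.lsingle_apply, LinearMap.id_apply,
    coneOperator_single, simplexBoundary_single, map_sum]
  by_cases hb : b ∈ σ
  · rw [if_pos hb, map_zero, zero_add, Finset.sum_eq_single_of_mem b hb]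
    · have : (σ.erase b).filter (· < b) = σ.filter (· < b) := by
        rw [Finset.filter_erase, Finset.erase_eq_of_notMem (by simp)]
      rw [if_neg (by simp), Finset.insert_erase hb, this, ← mul_pow]
      simp
    · intro a _ hab
      rw [if_pos (by simp [hb, hab.symm])]
  · rw [if_neg hb, simplexBoundary_single_smul, Finset.sum_insert hb, Finset.erase_insert hb,
      Finset.filter_insert, if_neg (lt_irrefl b), one_mul, ← mul_pow, add_assoc,
      ← Finset.sum_add_distrib, Finset.sum_eq_zero]
    · simp
    · intro a ha
      have hab : a ≠ b := fun h => hb (h ▸ ha)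
      rw [if_neg (by simp [hb]), neg_one_pow_insert_erase ha hb,
        Finset.erase_insert_of_ne hab.symm, ← Finsupp.single_add, neg_add_cancel,
        Finsupp.single_zero]

theorem simplexBoundary_mem_supported {S T : Set (Finset V)}
    (h : ∀ σ ∈ S, ∀ a ∈ σ, σ.erase a ∈ T) {c : Finset V →₀ k} (hc : c ∈ Finsupp.supported k k S) :
    simplexBoundary k V c ∈ Finsupp.supported k k T := by
  rw [simplexBoundary, Finsupp.linearCombination_apply]
  exact Submodule.sum_mem _ fun σ hσ => Submodule.smul_mem _ _ <| Submodule.sum_mem _ fun a ha =>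
    Finsupp.single_mem_supported k _ (h σ (hc hσ) a ha)

theorem coneOperator_mem_supported {b : V} {S T : Set (Finset V)}
    (h : ∀ σ ∈ S, b ∉ σ → insert b σ ∈ T) {c : Finset V →₀ k}
    (hc : c ∈ Finsupp.supported k k S) :
    coneOperator k b c ∈ Finsupp.supported k k T := by
  rw [coneOperator, Finsupp.linearCombination_apply]
  refine Submodule.sum_mem _ fun σ hσ => Submodule.smul_mem _ _ ?_
  split_ifs with hb
  · exact zero_mem _
  · exact Finsupp.single_mem_supported k _ (h σ (hc hσ) hb)

theorem simplexBoundary_mem_simplicialChains {K : PreAbstractSimplicialComplex V} {n : ℕ}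
    {c : Finset V →₀ k} (hc : c ∈ simplicialChains k K (n + 1)) :
    simplexBoundary k V c ∈ simplicialChains k K n :=
  (simplicialBoundaries_le_reducedCycles k K n (Submodule.mem_map_of_mem hc)).1

end Cone

/-! ### Homology of a complex glued at a vertex -/

section Gluing

open Finsupp

theorem filter_mem_supported {k V : Type*} [CommRing k] {S T : Set (Finset V)} {p : Finset V → Prop} [DecidablePred p]
    (h : ∀ σ ∈ S, p σ → σ ∈ T) {c : Finset V →₀ k} (hc : c ∈ supported k k S) :
    c.filter p ∈ supported k k T := by
  intro σ hσ
  rw [Finset.mem_coe, support_filter, Finset.mem_filter] at hσ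
  exact h σ (hc hσ.1) hσ.2

variable {k : Type*} [CommRing k] {V : Type*} [LinearOrder V]
  {K : PreAbstractSimplicialComplex V} {A B : Set V} {b : V}

/-- A chain whose boundary has no mixed simplices is homologous to a chain without mixed
simplices, provided that the mixed simplices of `K` may be extended by `b`. -/
theorem exists_sub_boundary_mem_supported (hbA : b ∈ A) (hbB : b ∈ B)
    (hmixed : ∀ σ ∈ K, ¬ (σ : Set V) ⊆ A → ¬ (σ : Set V) ⊆ B → insert b σ ∈ K) {n : ℕ}
    {c : Finset V →₀ k} (hc : c ∈ simplicialChains k K n)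
    (hdc : simplexBoundary k V c ∈ supported k k {σ : Finset V | (σ : Set V) ⊆ A ∨ (σ : Set V) ⊆ B}) :
    ∃ e ∈ simplicialChains k K (n + 1), c - simplexBoundary k V e ∈
      supported k k {σ : Finset V | (σ ∈ K ∧ σ.card = n + 1) ∧ ((σ : Set V) ⊆ A ∨ (σ : Set V) ⊆ B)} := by
  classical
  set N : Set (Finset V) := {σ : Finset V | (σ : Set V) ⊆ A ∨ (σ : Set V) ⊆ B} with hN
  -- `m` is the mixed part of `c`; coning it off replaces it by the cone on its boundary.
  set m := c.filter (· ∉ N) with hm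
  have hcm : c - m ∈ supported k k N := by
    rw [hm, sub_eq_of_eq_add (filter_add_filter_not c (· ∈ N)).symm]
    exact filter_mem_supported (fun _ _ h => h) hc
  have he : coneOperator k b m ∈ simplicialChains k K (n + 1) := by
    refine coneOperator_mem_supported (S := {σ : Finset V | (σ ∈ K ∧ σ.card = n + 1) ∧ σ ∉ N}) ?_ ?_
    swap
    · refine filter_mem_supported ?_ hc
      exact fun σ h₁ h₂ => ⟨h₁, h₂⟩
    rintro σ ⟨⟨hσ, hcard⟩, hσN⟩ hbσ
    rw [hN, Set.mem_ofPred_eq, not_or] at hσN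
    exact ⟨hmixed σ hσ hσN.1 hσN.2, by rw [Finset.card_insert_of_notMem hbσ, hcard]⟩
  have hdm : simplexBoundary k V m ∈ supported k k N := by
    rw [← sub_sub_cancel c m, map_sub]
    -- Faces of unmixed simplices are unmixed, so `∂m`, the difference of `∂c` and `∂(c - m)`, is
    -- unmixed.
    refine Submodule.sub_mem _ hdc (simplexBoundary_mem_supported (fun σ hσ a _ => ?_) hcm)
    have : ((σ.erase a : Finset V) : Set V) ⊆ σ := Finset.coe_subset.2 (Finset.erase_subset a σ)
    exact hσ.imp this.trans this.trans
  refine ⟨coneOperator k b m, he, ?_⟩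
  have hsub : c - simplexBoundary k V (coneOperator k b m) =
      (c - m) + coneOperator k b (simplexBoundary k V m) := by
    rw [eq_sub_of_add_eq' (simplexBoundary_coneOperator_add b m)]
    abel
  have h₁ : c - simplexBoundary k V (coneOperator k b m) ∈ supported k k N := by
    rw [hsub]
    refine Submodule.add_mem _ hcm (coneOperator_mem_supported (fun σ hσ _ => ?_) hdm)
    -- Since `b` lies in both `A` and `B`, coning with `b` keeps an unmixed simplex unmixed.
    simp only [hN, Set.mem_ofPred_eq, Finset.coe_insert, Set.insert_subset_iff] at hσ ⊢
    tauto
  have h₂ := Submodule.sub_mem _ hc (simplexBoundary_mem_simplicialChains he)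
  exact fun σ hσ => ⟨h₂ hσ, h₁ hσ⟩

variable {K₁ K₂ : PreAbstractSimplicialComplex V}

/-- A chain in the union of two complexes that meet in the vertex `b` splits compatibly with a
given splitting of its boundary. -/
theorem exists_add_of_mem_supported (hAB : A ∩ B ⊆ {b})
    (hK₁ : ∀ σ, σ ∈ K₁ ↔ σ ∈ K ∧ (σ : Set V) ⊆ A) (hK₂ : ∀ σ, σ ∈ K₂ ↔ σ ∈ K ∧ (σ : Set V) ⊆ B)
    (hb₁ : {b} ∈ K₁) (hb₂ : {b} ∈ K₂) {n : ℕ} {c u₁ u₂ : Finset V →₀ k}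
    (hc : c ∈ supported k k
      {σ : Finset V | (σ ∈ K ∧ σ.card = n + 1) ∧ ((σ : Set V) ⊆ A ∨ (σ : Set V) ⊆ B)})
    (hu₁ : u₁ ∈ supported k k {σ : Finset V | (σ : Set V) ⊆ A ∧ σ.card = n})
    (hu₂ : u₂ ∈ supported k k {σ : Finset V | (σ : Set V) ⊆ B ∧ σ.card = n})
    (hdu₁ : simplexBoundary k V u₁ = 0) (hdc : simplexBoundary k V c = u₁ + u₂) :
    ∃ c₁ ∈ simplicialChains k K₁ n, ∃ c₂ ∈ simplicialChains k K₂ n, c = c₁ + c₂ ∧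
      simplexBoundary k V c₁ = u₁ ∧ simplexBoundary k V c₂ = u₂ := by
  classical
  set p := c.filter (fun σ : Finset V => (σ : Set V) ⊆ A) with hp
  set q := c.filter (fun σ : Finset V => ¬ (σ : Set V) ⊆ A) with hq
  have hpq : p + q = c := filter_add_filter_not _ _
  have hp₁ : p ∈ simplicialChains k K₁ n := by
    refine filter_mem_supported ?_ hc
    exact fun σ h hA => ⟨(hK₁ σ).2 ⟨h.1.1, hA⟩, h.1.2⟩
  have hq₂ : q ∈ simplicialChains k K₂ n := by
    refine filter_mem_supported ?_ hc
    exact fun σ h hA => ⟨(hK₂ σ).2 ⟨h.1.1, h.2.resolve_left hA⟩, h.1.2⟩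
  have hface : ∀ {C : Set V} {L : PreAbstractSimplicialComplex V},
      (∀ σ, σ ∈ L ↔ σ ∈ K ∧ (σ : Set V) ⊆ C) → ∀ {x}, x ∈ simplicialChains k L n →
      simplexBoundary k V x ∈ supported k k {σ : Finset V | (σ : Set V) ⊆ C ∧ σ.card = n} := by
    intro C L hL x hx
    refine simplexBoundary_mem_supported ?_ hx
    refine fun σ hσ a ha => ⟨?_, ?_⟩
    · exact (Finset.coe_subset.2 (Finset.erase_subset a σ)).trans ((hL σ).1 hσ.1).2
    · rw [Finset.card_erase_of_mem ha, hσ.2, Nat.add_sub_cancel]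
  -- `w` is the error of the naive splitting `p + q`. It is a cycle supported in both `A` and `B`,
  -- hence the boundary of its own cone, which is added to `p` and subtracted from `q`.
  set w := u₁ - simplexBoundary k V p with hw
  have hw' : w = simplexBoundary k V q - u₂ := by
    rw [← hpq, map_add] at hdc
    rw [hw, sub_eq_sub_iff_add_eq_add, ← hdc, add_comm]
  have hwA : w ∈ supported k k {σ : Finset V | (σ : Set V) ⊆ A ∧ σ.card = n} :=
    Submodule.sub_mem _ hu₁ (hface hK₁ hp₁)
  have hwB : w ∈ supported k k {σ : Finset V | (σ : Set V) ⊆ B ∧ σ.card = n} := by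
    rw [hw']
    exact Submodule.sub_mem _ (hface hK₂ hq₂) hu₂
  have hdw : simplexBoundary k V w = 0 := by
    rw [hw, map_sub, hdu₁, simplexBoundary_simplexBoundary, sub_zero]
  have hcone : simplexBoundary k V (coneOperator k b w) = w := by
    simpa [hdw] using simplexBoundary_coneOperator_add b w
  have hmem : ∀ L : PreAbstractSimplicialComplex V, {b} ∈ L →
      coneOperator k b w ∈ simplicialChains k L n := by
    intro L hL
    refine coneOperator_mem_supported
      (S := {σ : Finset V | ((σ : Set V) ⊆ A ∧ σ.card = n) ∧ (σ : Set V) ⊆ B}) ?_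
      (fun σ hσ => ⟨hwA hσ, (hwB hσ).1⟩)
    rintro σ ⟨⟨hA, hn⟩, hB⟩ hbσ
    refine ⟨?_, by rw [Finset.card_insert_of_notMem hbσ, hn]⟩
    -- A simplex of `w` avoiding `b` lies in `A ∩ B ⊆ {b}`, so it is empty. The correction is thus a
    -- multiple of the vertex `b`, nonzero only when `n = 0`, where it balances the augmentations.
    have : σ = ∅ := Finset.eq_empty_of_forall_notMem fun x hx =>
      hbσ ((hAB ⟨hA hx, hB hx⟩ : x = b) ▸ hx)
    simpa [this] using hL
  refine ⟨p + coneOperator k b w, Submodule.add_mem _ hp₁ (hmem _ hb₁),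
    q - coneOperator k b w, Submodule.sub_mem _ hq₂ (hmem _ hb₂), ?_, ?_, ?_⟩
  · rw [← hpq]; abel
  · rw [map_add, hcone, hw]; abel
  · rw [map_sub, hcone, hw']; abel

theorem simplicialChains_mono {V : Type*} {L K : PreAbstractSimplicialComplex V} (h : ∀ σ ∈ L, σ ∈ K)
    (n : ℕ) : simplicialChains k L n ≤ simplicialChains k K n :=
  supported_mono fun σ hσ => ⟨h σ hσ.1, hσ.2⟩

theorem reducedCycles_mono {L K : PreAbstractSimplicialComplex V} (h : ∀ σ ∈ L, σ ∈ K)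
    (n : ℕ) : reducedCycles k L n ≤ reducedCycles k K n :=
  inf_le_inf_right _ (simplicialChains_mono h n)

theorem simplicialBoundaries_mono {L K : PreAbstractSimplicialComplex V} (h : ∀ σ ∈ L, σ ∈ K)
    (n : ℕ) : simplicialBoundaries k L n ≤ simplicialBoundaries k K n :=
  Submodule.map_mono (simplicialChains_mono h (n + 1))

/-- The map of reduced homology induced by an inclusion of complexes. -/
def reducedHomologyInclusion (k : Type*) [CommRing k] {L K : PreAbstractSimplicialComplex V}
    (h : ∀ σ ∈ L, σ ∈ K) (n : ℕ) : reducedHomology k L n →ₗ[k] reducedHomology k K n :=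
  Submodule.mapQ _ _ (Submodule.inclusion (reducedCycles_mono h n))
    fun _ hz => simplicialBoundaries_mono h n hz

theorem mk_eq_zero_iff {L : PreAbstractSimplicialComplex V} {n : ℕ} (z : reducedCycles k L n) :
    (Submodule.Quotient.mk z : reducedHomology k L n) = 0 ↔
      (z : Finset V →₀ k) ∈ simplicialBoundaries k L n :=
  Submodule.Quotient.mk_eq_zero _

theorem reducedHomologyInclusion_mk {L : PreAbstractSimplicialComplex V} (h : ∀ σ ∈ L, σ ∈ K)
    {n : ℕ} (z : reducedCycles k L n) :
    reducedHomologyInclusion k h n (Submodule.Quotient.mk z) =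
      Submodule.Quotient.mk (Submodule.inclusion (reducedCycles_mono h n) z) :=
  rfl

theorem reducedHomologyInclusion_add_eq_mk_iff (h₁ : ∀ σ ∈ K₁, σ ∈ K) (h₂ : ∀ σ ∈ K₂, σ ∈ K)
    {n : ℕ} (z₁ : reducedCycles k K₁ n) (z₂ : reducedCycles k K₂ n) (z : reducedCycles k K n) :
    reducedHomologyInclusion k h₁ n (Submodule.Quotient.mk z₁) +
        reducedHomologyInclusion k h₂ n (Submodule.Quotient.mk z₂) = Submodule.Quotient.mk z ↔
      (z₁ + z₂ - z : Finset V →₀ k) ∈ simplicialBoundaries k K n := by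
  rw [reducedHomologyInclusion_mk, reducedHomologyInclusion_mk, ← Submodule.Quotient.mk_add,
    Submodule.Quotient.eq]
  rfl

/-- If `K` consists of two subcomplexes that meet in the vertex `b`, and of simplices that may be
extended by `b`, then its reduced homology is the direct sum of those of the subcomplexes. -/
theorem nonempty_reducedHomology_equiv_prod (hbA : b ∈ A) (hbB : b ∈ B) (hAB : A ∩ B ⊆ {b})
    (hK₁ : ∀ σ, σ ∈ K₁ ↔ σ ∈ K ∧ (σ : Set V) ⊆ A) (hK₂ : ∀ σ, σ ∈ K₂ ↔ σ ∈ K ∧ (σ : Set V) ⊆ B)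
    (hb : {b} ∈ K)
    (hmixed : ∀ σ ∈ K, ¬ (σ : Set V) ⊆ A → ¬ (σ : Set V) ⊆ B → insert b σ ∈ K) (n : ℕ) :
    Nonempty (reducedHomology k K n ≃ₗ[k] reducedHomology k K₁ n × reducedHomology k K₂ n) := by
  have hb₁ : {b} ∈ K₁ := (hK₁ _).2 ⟨hb, by simpa using hbA⟩
  have hb₂ : {b} ∈ K₂ := (hK₂ _).2 ⟨hb, by simpa using hbB⟩
  -- This serves both halves: with `m = n + 1` and `u₁`, `u₂` the given cycles it yields
  -- injectivity; with `m = n` and zero boundaries, surjectivity.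
  have split : ∀ {m : ℕ} {c u₁ u₂ : Finset V →₀ k}, c ∈ simplicialChains k K m →
      u₁ ∈ supported k k {σ : Finset V | (σ : Set V) ⊆ A ∧ σ.card = m} →
      u₂ ∈ supported k k {σ : Finset V | (σ : Set V) ⊆ B ∧ σ.card = m} →
      simplexBoundary k V u₁ = 0 → simplexBoundary k V c = u₁ + u₂ →
      ∃ e ∈ simplicialChains k K (m + 1), ∃ c₁ ∈ simplicialChains k K₁ m,
        ∃ c₂ ∈ simplicialChains k K₂ m, c - simplexBoundary k V e = c₁ + c₂ ∧
          simplexBoundary k V c₁ = u₁ ∧ simplexBoundary k V c₂ = u₂ := by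
    intro m c u₁ u₂ hc hu₁ hu₂ hdu₁ hdc
    obtain ⟨e, he, hce⟩ := exists_sub_boundary_mem_supported hbA hbB hmixed hc (by
      rw [hdc]
      exact Submodule.add_mem _ (supported_mono (fun _ h => Or.inl h.1) hu₁)
        (supported_mono (fun _ h => Or.inr h.1) hu₂))
    exact ⟨e, he, exists_add_of_mem_supported hAB hK₁ hK₂ hb₁ hb₂ hce hu₁ hu₂ hdu₁
      (by rw [map_sub, simplexBoundary_simplexBoundary, sub_zero, hdc])⟩
  have h₁ : ∀ σ ∈ K₁, σ ∈ K := fun σ h => ((hK₁ σ).1 h).1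
  have h₂ : ∀ σ ∈ K₂, σ ∈ K := fun σ h => ((hK₂ σ).1 h).1
  let φ : reducedHomology k K₁ n × reducedHomology k K₂ n →ₗ[k] reducedHomology k K n :=
    (reducedHomologyInclusion k h₁ n).coprod (reducedHomologyInclusion k h₂ n)
  refine ⟨(LinearEquiv.ofBijective φ ⟨?_, ?_⟩).symm⟩
  · rw [injective_iff_map_eq_zero]
    rintro ⟨z₁, z₂⟩ h
    induction z₁ using Submodule.Quotient.induction_on with | _ z₁ => ?_
    induction z₂ using Submodule.Quotient.induction_on with | _ z₂ => ?_
    have hmem := (reducedHomologyInclusion_add_eq_mk_iff h₁ h₂ z₁ z₂ 0).1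
      (h.trans (Submodule.Quotient.mk_zero _).symm)
    rw [ZeroMemClass.coe_zero, sub_zero] at hmem
    obtain ⟨c, hc, hdc⟩ := hmem
    have hz₁ : (z₁ : Finset V →₀ k) ∈
        supported k k {σ : Finset V | (σ : Set V) ⊆ A ∧ σ.card = n + 1} :=
      fun σ hσ => ⟨((hK₁ σ).1 (z₁.2.1 hσ).1).2, (z₁.2.1 hσ).2⟩
    have hz₂ : (z₂ : Finset V →₀ k) ∈
        supported k k {σ : Finset V | (σ : Set V) ⊆ B ∧ σ.card = n + 1} :=
      fun σ hσ => ⟨((hK₂ σ).1 (z₂.2.1 hσ).1).2, (z₂.2.1 hσ).2⟩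
    obtain ⟨_, _, c₁, hc₁, c₂, hc₂, _, hd₁, hd₂⟩ := split hc hz₁ hz₂ z₁.2.2 hdc
    exact Prod.ext ((mk_eq_zero_iff z₁).2 ⟨c₁, hc₁, hd₁⟩) ((mk_eq_zero_iff z₂).2 ⟨c₂, hc₂, hd₂⟩)
  · intro z
    induction z using Submodule.Quotient.induction_on with | _ z => ?_
    obtain ⟨e, he, c₁, hc₁, c₂, hc₂, hsum, hd₁, hd₂⟩ := split z.2.1 (zero_mem _) (zero_mem _)
      (map_zero _) (by rw [add_zero]; exact z.2.2)
    refine ⟨(Submodule.Quotient.mk ⟨c₁, hc₁, hd₁⟩, Submodule.Quotient.mk ⟨c₂, hc₂, hd₂⟩), ?_⟩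
    refine (reducedHomologyInclusion_add_eq_mk_iff h₁ h₂ _ _ z).2 ?_
    rw [← hsum, sub_sub_cancel_left]
    exact Submodule.neg_mem _ ⟨e, he, rfl⟩

end Gluing

/-! ### Invariance of homology under injective vertex maps -/

section Embedding

variable (k : Type*) [CommRing k] {V W : Type*} [LinearOrder V] [LinearOrder W] (f : V ↪ W)

/-- The pairs of vertices of `σ` whose order is reversed by `f`. -/
def inversions (σ : Finset V) : Finset (V × V) :=
  (σ ×ˢ σ).filter fun p => p.1 < p.2 ∧ f p.2 < f p.1

/-- Let `P` count the vertices after `a` sent before `f a`, `Q` those before `a` sent after it, and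
`S` those before on both sides. Erasing `a` loses `P + Q` inversions, while the positions of `f a`
and `a` are `P + S` and `Q + S`. Modulo 2 this makes the signs of `chainMap` commute with the
boundary. -/
theorem card_inversions_add {σ : Finset V} {a : V} (ha : a ∈ σ) :
    (inversions f σ).card + ((σ.map f).filter (· < f a)).card =
      (inversions f (σ.erase a)).card + (σ.filter (· < a)).card +
        2 * (σ.filter fun x => a < x ∧ f x < f a).card := by
  have h₁ : (inversions f σ).card = (inversions f (σ.erase a)).card +
      ((σ.filter fun x => a < x ∧ f x < f a).card +
        (σ.filter fun x => x < a ∧ f a < f x).card) := by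
    have e : inversions f σ = inversions f (σ.erase a) ∪
        ((σ.filter fun x => a < x ∧ f x < f a).image (fun x => (a, x)) ∪
          (σ.filter fun x => x < a ∧ f a < f x).image (fun x => (x, a))) := by
      ext ⟨x, y⟩
      simp only [inversions, Finset.mem_filter, Finset.mem_product, Finset.mem_union,
        Finset.mem_image, Finset.mem_erase, Prod.mk.injEq]
      constructor
      · rintro ⟨⟨hx, hy⟩, h⟩
        by_cases hxa : x = a
        · subst hxa
          exact .inr (.inl ⟨y, ⟨hy, h⟩, rfl, rfl⟩)
        · by_cases hya : y = a
          · subst hya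
            exact .inr (.inr ⟨x, ⟨hx, h⟩, rfl, rfl⟩)
          · exact .inl ⟨⟨⟨hxa, hx⟩, hya, hy⟩, h⟩
      · rintro (⟨⟨⟨_, hx⟩, _, hy⟩, h⟩ | ⟨_, ⟨hx, h⟩, rfl, rfl⟩ | ⟨_, ⟨hx, h⟩, rfl, rfl⟩)
        exacts [⟨⟨hx, hy⟩, h⟩, ⟨⟨ha, hx⟩, h⟩, ⟨⟨hx, ha⟩, h⟩]
    rw [e, Finset.card_union_of_disjoint, Finset.card_union_of_disjoint,
      Finset.card_image_of_injective _ (Prod.mk_right_injective a),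
      Finset.card_image_of_injective _ (Prod.mk_left_injective a)]
    · rw [Finset.disjoint_left]
      rintro ⟨x, y⟩ h h'
      simp only [Finset.mem_filter, Finset.mem_image, Prod.mk.injEq] at h h'
      obtain ⟨_, ⟨_, h, _⟩, rfl, rfl⟩ := h
      obtain ⟨_, ⟨_, h', _⟩, rfl, _⟩ := h'
      exact lt_irrefl _ h'
    · rw [Finset.disjoint_left]
      rintro ⟨x, y⟩ h h'
      simp only [inversions, Finset.mem_filter, Finset.mem_image, Prod.mk.injEq, Finset.mem_union,
        Finset.mem_product, Finset.mem_erase] at h h'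
      rcases h' with ⟨_, _, rfl, _⟩ | ⟨_, _, _, rfl⟩
      exacts [h.1.1.1 rfl, h.1.2.1 rfl]
  have h₂ : ((σ.map f).filter (· < f a)).card = (σ.filter fun x => a < x ∧ f x < f a).card +
      (σ.filter fun x => x < a ∧ f x < f a).card := by
    rw [Finset.filter_map, Finset.card_map, ← Finset.card_union_of_disjoint]
    · congr 1
      ext x
      simp only [Finset.mem_filter, Finset.mem_union, Function.comp_apply]
      have : f x < f a → x ≠ a := by rintro h rfl; exact lt_irrefl _ h
      have := lt_trichotomy x a
      tauto
    · exact Finset.disjoint_filter.2 fun x _ h h' => lt_asymm h.1 h'.1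
  have h₃ : (σ.filter (· < a)).card = (σ.filter fun x => x < a ∧ f a < f x).card +
      (σ.filter fun x => x < a ∧ f x < f a).card := by
    rw [← Finset.card_union_of_disjoint]
    · congr 1
      ext x
      simp only [Finset.mem_filter, Finset.mem_union]
      have : x < a → f x ≠ f a := fun h h' => h.ne (f.injective h')
      have := lt_trichotomy (f x) (f a)
      tauto
    · exact Finset.disjoint_filter.2 fun x _ h h' => lt_asymm h.2 h'.2
  omega

/-- The chain map induced by an injective vertex map. -/
def chainMap : (Finset V →₀ k) →ₗ[k] (Finset W →₀ k) :=
  Finsupp.linearCombination k fun σ : Finset V =>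
    Finsupp.single (σ.map f) ((-1 : k) ^ (inversions f σ).card)

theorem chainMap_single (σ : Finset V) (r : k) :
    chainMap k f (Finsupp.single σ r) =
      Finsupp.single (σ.map f) (r * (-1 : k) ^ (inversions f σ).card) := by
  simp [chainMap]

theorem chainMap_simplexBoundary (c : Finset V →₀ k) :
    chainMap k f (simplexBoundary k V c) = simplexBoundary k W (chainMap k f c) := by
  suffices h : chainMap k f ∘ₗ simplexBoundary k V = simplexBoundary k W ∘ₗ chainMap k f from
    LinearMap.congr_fun h c
  refine Finsupp.lhom_ext' fun σ => LinearMap.ext_ring ?_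
  simp only [LinearMap.comp_apply, Finsupp.lsingle_apply, map_sum,
    chainMap_single, simplexBoundary_single_smul, Finset.sum_map, one_mul]
  refine Finset.sum_congr rfl fun a ha => ?_
  rw [Finset.map_erase, ← pow_add, ← pow_add, card_inversions_add f ha, pow_add _ _ (2 * _),
    pow_mul, neg_one_sq, one_pow, mul_one, add_comm]

/-- Distinct simplices have distinct images under an embedding, so every coefficient of `c` can be
read off up to a sign. Injectivity of `chainMap` follows. -/
theorem chainMap_apply_map (c : Finset V →₀ k) (σ : Finset V) :
    chainMap k f c (σ.map f) = c σ * (-1 : k) ^ (inversions f σ).card := by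
  induction c using Finsupp.induction_linear with
  | zero => simp
  | add c d hc hd => simp [hc, hd, add_mul]
  | single τ r =>
    rw [chainMap_single]
    by_cases h : τ = σ
    · simp [h]
    · rw [Finsupp.single_eq_of_ne' (by simpa using h), Finsupp.single_eq_of_ne' h, zero_mul]

theorem chainMap_injective : Function.Injective (chainMap k f) := by
  rw [injective_iff_map_eq_zero]
  intro c hc
  ext σ
  have h := chainMap_apply_map k f c σ
  rw [hc, Finsupp.zero_apply] at h
  exact ((isUnit_one.neg.pow _).mul_left_eq_zero.1 h.symm)

variable {f} {L : PreAbstractSimplicialComplex V} {K : PreAbstractSimplicialComplex W}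

theorem map_simplicialChains_chainMap
    (h : ∀ τ, τ ∈ K ↔ ∃ σ ∈ L, σ.map f = τ) (n : ℕ) :
    (simplicialChains k L n).map (chainMap k f) = simplicialChains k K n := by
  apply le_antisymm
  · rw [simplicialChains, Finsupp.supported_eq_span_single, Submodule.map_span, Submodule.span_le]
    rintro _ ⟨_, ⟨σ, hσ, rfl⟩, rfl⟩
    rw [SetLike.mem_coe, chainMap_single]
    exact Finsupp.single_mem_supported k _ ⟨(h _).2 ⟨σ, hσ.1, rfl⟩, by rw [Finset.card_map, hσ.2]⟩
  · rw [simplicialChains, simplicialChains, Finsupp.supported_eq_span_single, Submodule.span_le]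
    rintro _ ⟨τ, ⟨hτ, hcard⟩, rfl⟩
    obtain ⟨σ, hσ, rfl⟩ := (h τ).1 hτ
    -- The coefficient is the sign of `f` on `σ`, which squares to `1`.
    refine ⟨Finsupp.single σ ((-1) ^ (inversions f σ).card),
      Finsupp.single_mem_supported k _ ⟨hσ, by rw [← hcard, Finset.card_map]⟩, ?_⟩
    rw [chainMap_single, ← mul_pow]
    simp

theorem map_reducedCycles_chainMap (h : ∀ τ, τ ∈ K ↔ ∃ σ ∈ L, σ.map f = τ) (n : ℕ) :
    (reducedCycles k L n).map (chainMap k f) = reducedCycles k K n := by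
  rw [reducedCycles, reducedCycles, ← map_simplicialChains_chainMap k h]
  ext z
  simp only [Submodule.mem_map, Submodule.mem_inf, LinearMap.mem_ker]
  constructor
  · rintro ⟨c, ⟨hc, hdc⟩, rfl⟩
    exact ⟨⟨c, hc, rfl⟩, by rw [← chainMap_simplexBoundary, hdc, map_zero]⟩
  · rintro ⟨⟨c, hc, rfl⟩, hdc⟩
    rw [← chainMap_simplexBoundary] at hdc
    exact ⟨c, ⟨hc, chainMap_injective k f (hdc.trans (map_zero _).symm)⟩, rfl⟩

theorem map_simplicialBoundaries_chainMap (h : ∀ τ, τ ∈ K ↔ ∃ σ ∈ L, σ.map f = τ) (n : ℕ) :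
    (simplicialBoundaries k L n).map (chainMap k f) = simplicialBoundaries k K n := by
  rw [simplicialBoundaries, simplicialBoundaries, ← map_simplicialChains_chainMap k h,
    ← Submodule.map_comp, ← Submodule.map_comp]
  exact congrArg (Submodule.map · _) (LinearMap.ext (chainMap_simplexBoundary k f))

/-- An injective vertex map identifies the reduced homology of a complex with that of its image,
whatever the vertex orders. -/
def reducedHomologyEquivOfEmbedding (h : ∀ τ, τ ∈ K ↔ ∃ σ ∈ L, σ.map f = τ) (n : ℕ) :
    reducedHomology k L n ≃ₗ[k] reducedHomology k K n :=
  let e : reducedCycles k L n ≃ₗ[k] reducedCycles k K n :=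
    (Submodule.equivMapOfInjective (chainMap k f) (chainMap_injective k f) _).trans
      (LinearEquiv.ofEq _ _ (map_reducedCycles_chainMap k h n))
  Submodule.Quotient.equiv _ _ e <| by
    have he : ∀ z, (e z : Finset W →₀ k) = chainMap k f z := fun _ => rfl
    ext z
    simp only [Submodule.mem_map, Submodule.submoduleOf, Submodule.mem_comap,
      Submodule.subtype_apply, ← map_simplicialBoundaries_chainMap k h]
    constructor
    · rintro ⟨y, hy, rfl⟩
      exact ⟨y, hy, (he y).symm⟩
    · rintro ⟨y, hy, hyz⟩
      -- The preimage of a boundary is itself a boundary, hence a cycle.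
      exact ⟨⟨y, simplicialBoundaries_le_reducedCycles k L n hy⟩, hy, Subtype.ext hyz⟩

end Embedding

/-- The subcomplex of the simplices with vertices in `A`. -/
def PreAbstractSimplicialComplex.restrict {V : Type*} (K : PreAbstractSimplicialComplex V)
    (A : Set V) : PreAbstractSimplicialComplex V where
  faces := {σ | σ ∈ K ∧ (σ : Set V) ⊆ A}
  isRelLowerSet_faces := by
    rintro σ ⟨hσ, hA⟩
    refine ⟨(K.isRelLowerSet_faces hσ).1, fun τ hτ hne => ⟨?_, ?_⟩⟩
    · exact (K.isRelLowerSet_faces hσ).2 hτ hne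
    · exact (Finset.coe_subset.2 hτ).trans hA

theorem PreAbstractSimplicialComplex.mem_restrict_range_iff {V W : Type*} (f : V ↪ W)
    {L : PreAbstractSimplicialComplex V} {K : PreAbstractSimplicialComplex W}
    (h : ∀ σ, σ.map f ∈ K ↔ σ ∈ L) (τ : Finset W) :
    τ ∈ K.restrict (Set.range f) ↔ ∃ σ ∈ L, σ.map f = τ := by
  constructor
  · classical
    rintro ⟨hτ, hA⟩
    rw [← Set.image_univ] at hA
    obtain ⟨σ, -, rfl⟩ := Finset.subset_set_image_iff.1 hA
    rw [← Finset.map_eq_image] at hτ ⊢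
    exact ⟨σ, (h σ).1 hτ, rfl⟩
  · rintro ⟨σ, hσ, rfl⟩
    exact ⟨(h σ).2 hσ, by simp⟩

end

theorem mainTheorem1 {X₁ X₂ : Type*} (G₁ : Network X₁) (G₂ : Network X₂) (x₀ : X₁) (y₀ : X₂)
    [LinearOrder X₁] [LinearOrder X₂] [LinearOrder (WedgeVertex x₀ y₀)] (δ : ℝ)
    (hx₀ : G₁.pathCompletion.SharesNeighborhood δ x₀)
    (hy₀ : G₂.pathCompletion.SharesNeighborhood δ y₀) (n : ℕ) :
    Nonempty (reducedHomology ℝ ((G₁.wedge G₂ x₀ y₀).dowker δ) n ≃ₗ[ℝ]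
      reducedHomology ℝ (G₁.dowker δ) n × reducedHomology ℝ (G₂.dowker δ) n) := by
  -- For `0 ≤ δ` the base vertex is its own `δ`-neighbor, hence a simplex of `K`, as the gluing
  -- theorem requires.
  have hδ := Network.nonneg_of_sharesNeighborhood hx₀
  set K := (G₁.wedge G₂ x₀ y₀).dowker δ
  let f₁ := WedgeVertex.inlEmbedding x₀ y₀
  let f₂ := WedgeVertex.inrEmbedding x₀ y₀
  have e₁ := reducedHomologyEquivOfEmbedding ℝ (PreAbstractSimplicialComplex.mem_restrict_range_iff
    f₁ (L := G₁.dowker δ) (K := K)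
    fun _ => Network.map_inl_mem_dowker_wedge G₁ G₂ x₀ y₀) n
  have e₂ := reducedHomologyEquivOfEmbedding ℝ (PreAbstractSimplicialComplex.mem_restrict_range_iff
    f₂ (L := G₂.dowker δ) (K := K)
    fun _ => Network.map_inr_mem_dowker_wedge G₁ G₂ x₀ y₀) n
  have hAB : Set.range f₁ ∩ Set.range f₂ ⊆ {WedgeVertex.inl x₀ y₀ x₀} := by
    rintro _ ⟨⟨a, rfl⟩, b, hb⟩
    -- The first retraction sends the second side to `x₀` and fixes `a`.
    have : x₀ = a := congrArg (WedgeVertex.fst x₀ y₀) hb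
    exact this ▸ rfl
  obtain ⟨e⟩ := nonempty_reducedHomology_equiv_prod (k := ℝ) (K := K)
    (A := Set.range f₁) (B := Set.range f₂) (K₁ := K.restrict (Set.range f₁)) (K₂ := K.restrict (Set.range f₂))
    (b := WedgeVertex.inl x₀ y₀ x₀) ⟨x₀, rfl⟩ ⟨y₀, (WedgeVertex.inl_base x₀ y₀).symm⟩ hAB
    (fun _ => Iff.rfl) (fun _ => Iff.rfl) (Network.singleton_mem_dowker _ hδ _)
    (fun _ hσ h₁ h₂ => Network.insert_base_mem_dowker_wedge G₁ G₂ x₀ y₀ hσ h₁ h₂) n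
  exact ⟨e.trans (e₁.symm.prodCongr e₂.symm)⟩
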